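/- Let EG (Euclidean geometry without Markov's principle) be the following theory in first-order intuitionistic predicate calculus with equality. The language has a ternary relation $B$ (strict betweenness), a quaternary relation $E$ (written $ab=cd$ for $E(a,b,c,d)$) and constants $\alpha,\beta,\gamma,c_1,c_2,c_3,c_4$. Abbreviations: - $a\,\#\,b$ ("$a,b$ are distinct"): $\exists c\,(B(c,a,b)\lor B(a,c,b)\lor B(a,b,c))$. - $T(a,b,c)$: $\neg(a\ne b\land\neg B(a,b,c)\land b\neq c)$; $L(a,b,c)$: $\neg\neg(B(c,a,b)\lor c=a\lor B(a,c,b)\lor c=b\lor B(a,b,c))$. - $R(a,b,c)$ (right angle): $\exists d\,(B(a,b,d)\land ab=bd\land ac=dc)\land a\#b\land c\#b\land a\#c$. - $Ray(a,b,x)$: $\exists d\,(B(d,a,b)\land B(d,a,x))$. - $apex(a,b,c)$: $\exists u,v\,(Ray(b,a,u)\land Ray(b,c,v)\land bu=bv\land u\#v)$. - $\angle abc=\angle a'b'c'$: $\exists u,v,u',v'\,(Ray(b,a,u)\land Ray(b,c,v)\land Ray(b',a',u')\land Ray(b',c',v')\land bu=b'u'\land bv=b'v'\land uv=u'v')$.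 - $0<abc$: $apex(a,b,c)\lor R(a,b,c)\lor\exists a',b',c'\,(\angle abc=\angle a'b'c'\land(R(b',a',c')\lor R(a',c',b')))$. - $abc<\pi$: $\exists d\,(B(d,b,a)\land 0<dbc)$; and $0<abc<\pi$ is the conjunction of $0<abc$ and $abc<\pi$. The axioms of EG are the universal closures of the following formulas. - Congruence: $ab=ba$; $ab=pq\land ab=rs\to pq=rs$; $ab=cc\to a=b$; $\neg\neg\,ab=cd\to ab=cd$. - Betweenness: $\neg B(a,b,a)$; $B(a,b,c)\to B(c,b,a)$; $B(a,b,d)\land B(b,c,d)\to B(a,b,c)$; $B(a,b,d)\land B(a,c,d)\land\neg B(a,b,c)\land\neg B(a,c,b)\to b=c$. - Extension: $a'\#b'\land ab=a'b'\to\exists e\,(T(a,b,e)\land be=cd)$; $a'\#b'\land ab=a'b'\land c'\#d'\land cd=c'd'\to\exists e\,(B(a,b,e)\land be=cd)$. - Five-segment: $a\#b\land T(a,b,c)\land T(a',b',c')\land ab=a'b'\land bc=b'c'\land ad=a'd'\land bd=b'd'\to cd=c'd'$. - Inner Pasch: $B(a,p,c)\land B(b,q,c)\land(0<acb<\pi\lor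 0<qpa<\pi)\to\exists x\,(B(p,x,b)\land B(a,x,q))$. - Outer Pasch: $B(a,p,c)\land B(b,c,q)\land(0<baq<\pi\lor 0<abq<\pi)\to\exists x\,(B(b,p,x)\land B(a,x,q))$. - Lower dimension: $\alpha\beta=\beta\gamma\land\alpha\beta=\alpha\gamma\land\alpha\ne\beta$; $B(\alpha,c_1,\beta)\land\alpha c_1=c_1\beta$; $B(\alpha,c_2,\gamma)\land\alpha c_2=c_2\gamma$; $B(\beta,c_3,\gamma)\land\beta c_3=c_3\gamma$; $B(\beta,c_4,c_2)\land B(\gamma,c_4,c_1)$. - Line-circle continuity: $a\#b\land B(u,a,v)\land cu=pq\land cv=pq\land B(u,c,v)\to\exists x,y\,(L(a,b,x)\land L(a,b,y)\land cx=pq\land cy=pq\land B(x,a,y))$, and the same formula with $B$ replaced by $T$ in its three displayed occurrences. - Circle-circle continuity: $ca=pq\land T(u,a,v)\land T(u,c',v)\land c'u=p'q'\land c'v=p'q'\land cb=pq\land B(c',w,b)\land c'w=p'q'\to\exists e\,(ce=pq\land c'e=p'q')$. - Euclid 5: $0<sqp<\pi\land pt=qt\land B(p,t,q)\land st=rt\land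 B(s,t,r)\land pr=qs\land B(q,a,r)\to\exists e\,(B(p,a,e)\land B(s,q,e))$. Theorem. EG proves, with intuitionistic logic, $$\forall a,b,c\,\bigl(0<abc<\pi\to a\,\#\,c\bigr).$$ Moreover, for right angles only the legs need be assumed to have distinct endpoints: EG proves, with intuitionistic logic, $$\forall a,b,c\,\bigl(\exists d\,(B(a,b,d)\land ab=bd\land ac=dc)\land a\#b\land c\#b\to a\,\#\,c\bigr).$$ -/

import Mathlib

namespace EG

/-! ### Intuitionistic first-order predicate calculus with equality

The language has a ternary relation symbol `betw` (strict betweenness), a quaternary relation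
symbol `cong` (equidistance), and seven constants. Formulas are well-scoped: `Formula n` is the
type of formulas whose free variables are among `n` variables (de Bruijn indices, the innermost
bound variable being `0`); sentences are the elements of `Formula 0`. -/

/-- The constants: the vertices of an equilateral triangle, the midpoints of its sides, and the
intersection point of two of its medians. -/
inductive Const : Type
  | alpha | beta | gamma | c1 | c2 | c3 | c4

inductive Term (n : ℕ) : Type
  | var (i : Fin n) : Term n
  | const (c : Const) : Term n

def Term.subst {n m : ℕ} (σ : Fin n → Term m) : Term n → Term m
  | .var i => σ i
  | .const c => .const c

/-- The same term, read in a context with one more (innermost) variable. -/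
def Term.shift {n : ℕ} (t : Term n) : Term (n + 1) :=
  t.subst fun i => .var i.succ

prefix:max "↟" => Term.shift

/-- `∨` and `∃` are primitive, as they must be in intuitionistic logic. -/
inductive Formula : ℕ → Type
  | falsum {n : ℕ} : Formula n
  | eq {n : ℕ} (s t : Term n) : Formula n
  | betw {n : ℕ} (a b c : Term n) : Formula n
  | cong {n : ℕ} (a b c d : Term n) : Formula n
  | and {n : ℕ} (φ ψ : Formula n) : Formula n
  | or {n : ℕ} (φ ψ : Formula n) : Formula n
  | imp {n : ℕ} (φ ψ : Formula n) : Formula n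
  | all {n : ℕ} (φ : Formula (n + 1)) : Formula n
  | ex {n : ℕ} (φ : Formula (n + 1)) : Formula n

/-- Extension of a substitution under a quantifier. -/
def up {n m : ℕ} (σ : Fin n → Term m) : Fin (n + 1) → Term (m + 1) :=
  Fin.cases (.var 0) fun i => (σ i).shift

/-- Simultaneous capture-avoiding substitution. -/
def Formula.subst : {n m : ℕ} → (Fin n → Term m) → Formula n → Formula m
  | _, _, _, .falsum => .falsum
  | _, _, σ, .eq s t => .eq (s.subst σ) (t.subst σ)
  | _, _, σ, .betw a b c => .betw (a.subst σ) (b.subst σ) (c.subst σ)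
  | _, _, σ, .cong a b c d => .cong (a.subst σ) (b.subst σ) (c.subst σ) (d.subst σ)
  | _, _, σ, .and φ ψ => .and (φ.subst σ) (ψ.subst σ)
  | _, _, σ, .or φ ψ => .or (φ.subst σ) (ψ.subst σ)
  | _, _, σ, .imp φ ψ => .imp (φ.subst σ) (ψ.subst σ)
  | _, _, σ, .all φ => .all (φ.subst (up σ))
  | _, _, σ, .ex φ => .ex (φ.subst (up σ))

def Formula.shift {n : ℕ} (φ : Formula n) : Formula (n + 1) :=
  φ.subst fun i => .var i.succ

/-- `φ.inst t` is the result of replacing the variable `0` of `φ` by `t`. -/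
def Formula.inst {n : ℕ} (φ : Formula (n + 1)) (t : Term n) : Formula n :=
  φ.subst (Fin.cases t Term.var)

/-- A sentence, read in a context with `n` variables. -/
def Formula.ofSentence {n : ℕ} (φ : Formula 0) : Formula n :=
  φ.subst fun i => i.elim0

def Formula.neg {n : ℕ} (φ : Formula n) : Formula n := .imp φ .falsum

/-- Universal closure. -/
def Formula.closure : {n : ℕ} → Formula n → Formula 0
  | 0, φ => φ
  | _ + 1, φ => (Formula.all φ).closure

infixr:35 " ⩑ " => Formula.and
infixr:30 " ⩒ " => Formula.or
infixr:25 " ⟹ " => Formula.imp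
prefix:max "∼" => Formula.neg

/-- Quantification over a point, in the form `exists_ fun x => …`. -/
def exists_ {n : ℕ} (f : Term (n + 1) → Formula (n + 1)) : Formula n := .ex (f (.var 0))

/-- Intuitionistic natural deduction with equality: `Derives T Γ φ` says that `φ` is derivable
from the open assumptions `Γ` and the sentences of the theory `T` as axioms. -/
inductive Derives (T : Set (Formula 0)) : {n : ℕ} → List (Formula n) → Formula n → Prop
  | ax {n : ℕ} {Γ : List (Formula n)} {φ : Formula 0} :
      φ ∈ T → Derives T Γ φ.ofSentence
  | hyp {n : ℕ} {Γ : List (Formula n)} {φ : Formula n} : φ ∈ Γ → Derives T Γ φ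
  | falsumE {n : ℕ} {Γ : List (Formula n)} {φ : Formula n} :
      Derives T Γ .falsum → Derives T Γ φ
  | andI {n : ℕ} {Γ : List (Formula n)} {φ ψ : Formula n} :
      Derives T Γ φ → Derives T Γ ψ → Derives T Γ (φ ⩑ ψ)
  | andE₁ {n : ℕ} {Γ : List (Formula n)} {φ ψ : Formula n} :
      Derives T Γ (φ ⩑ ψ) → Derives T Γ φ
  | andE₂ {n : ℕ} {Γ : List (Formula n)} {φ ψ : Formula n} :
      Derives T Γ (φ ⩑ ψ) → Derives T Γ ψ
  | orI₁ {n : ℕ} {Γ : List (Formula n)} {φ ψ : Formula n} :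
      Derives T Γ φ → Derives T Γ (φ ⩒ ψ)
  | orI₂ {n : ℕ} {Γ : List (Formula n)} {φ ψ : Formula n} :
      Derives T Γ ψ → Derives T Γ (φ ⩒ ψ)
  | orE {n : ℕ} {Γ : List (Formula n)} {φ ψ χ : Formula n} :
      Derives T Γ (φ ⩒ ψ) → Derives T (φ :: Γ) χ → Derives T (ψ :: Γ) χ → Derives T Γ χ
  | impI {n : ℕ} {Γ : List (Formula n)} {φ ψ : Formula n} :
      Derives T (φ :: Γ) ψ → Derives T Γ (φ ⟹ ψ)
  | impE {n : ℕ} {Γ : List (Formula n)} {φ ψ : Formula n} :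
      Derives T Γ (φ ⟹ ψ) → Derives T Γ φ → Derives T Γ ψ
  | allI {n : ℕ} {Γ : List (Formula n)} {φ : Formula (n + 1)} :
      Derives T (Γ.map Formula.shift) φ → Derives T Γ (.all φ)
  | allE {n : ℕ} {Γ : List (Formula n)} {φ : Formula (n + 1)} (t : Term n) :
      Derives T Γ (.all φ) → Derives T Γ (φ.inst t)
  | exI {n : ℕ} {Γ : List (Formula n)} {φ : Formula (n + 1)} (t : Term n) :
      Derives T Γ (φ.inst t) → Derives T Γ (.ex φ)
  | exE {n : ℕ} {Γ : List (Formula n)} {φ : Formula (n + 1)} {ψ : Formula n} :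
      Derives T Γ (.ex φ) → Derives T (φ :: Γ.map Formula.shift) ψ.shift → Derives T Γ ψ
  | eqI {n : ℕ} {Γ : List (Formula n)} (t : Term n) : Derives T Γ (.eq t t)
  | eqE {n : ℕ} {Γ : List (Formula n)} {φ : Formula (n + 1)} {s t : Term n} :
      Derives T Γ (.eq s t) → Derives T Γ (φ.inst s) → Derives T Γ (φ.inst t)

/-! ### Defined notions of EG -/

section Abbreviations

variable {n : ℕ}

/-- `B(a,b,c)`: strict betweenness. -/
abbrev B (a b c : Term n) : Formula n := .betw a b c

/-- `E(a,b,c,d)`, informally `ab = cd`. -/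
abbrev E (a b c d : Term n) : Formula n := .cong a b c d

/-- `a # b`: the points `a` and `b` are distinct. -/
def distinct (a b : Term n) : Formula n :=
  exists_ fun c => B c ↟a ↟b ⩒ B ↟a c ↟b ⩒ B ↟a ↟b c

/-- Non-strict betweenness. -/
def T (a b c : Term n) : Formula n :=
  ∼(∼(.eq a b) ⩑ ∼(B a b c) ⩑ ∼(.eq b c))

/-- Collinearity. -/
def L (a b c : Term n) : Formula n :=
  ∼∼(B c a b ⩒ .eq c a ⩒ B a c b ⩒ .eq c b ⩒ B a b c)

/-- Angle `abc` equals the adjacent angle obtained by reflecting `a` in `b`; nothing is said here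
about the points being distinct. -/
def equalsSupplement (a b c : Term n) : Formula n :=
  exists_ fun d => B ↟a ↟b d ⩑ E ↟a ↟b ↟b d ⩑ E ↟a ↟c d ↟c

/-- `R(a,b,c)`: `abc` is a right angle, with `a`, `b`, `c` pairwise distinct. -/
def rightAngle (a b c : Term n) : Formula n :=
  equalsSupplement a b c ⩑ distinct a b ⩑ distinct c b ⩑ distinct a c

/-- `x` lies on the (open) ray from `a` through `b`. -/
def ray (a b x : Term n) : Formula n :=
  exists_ fun d => B d ↟a ↟b ⩑ B d ↟a ↟x

/-- `abc` is an apex angle. -/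
def apex (a b c : Term n) : Formula n :=
  exists_ fun u => exists_ fun v =>
    ray ↟↟b ↟↟a ↟u ⩑ ray ↟↟b ↟↟c v ⩑ E ↟↟b ↟u ↟↟b v ⩑ distinct ↟u v

/-- Angles `abc` and `a'b'c'` are congruent. -/
def angleCong (a b c a' b' c' : Term n) : Formula n :=
  exists_ fun u' => exists_ fun v' => exists_ fun u => exists_ fun v =>
    ray ↟↟↟↟b ↟↟↟↟a ↟u ⩑ ray ↟↟↟↟b ↟↟↟↟c v ⩑
    ray ↟↟↟↟b' ↟↟↟↟a' ↟↟↟u' ⩑ ray ↟↟↟↟b' ↟↟↟↟c' ↟↟v' ⩑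
    E ↟↟↟↟b ↟u ↟↟↟↟b' ↟↟↟u' ⩑ E ↟↟↟↟b v ↟↟↟↟b' ↟↟v' ⩑ E ↟u v ↟↟↟u' ↟↟v'

/-- `0 < abc`: apex angle, right angle, or (acute) angle of a right triangle. -/
def posAngle (a b c : Term n) : Formula n :=
  apex a b c ⩒ rightAngle a b c ⩒
    exists_ fun a' => exists_ fun b' => exists_ fun c' =>
      angleCong ↟↟↟a ↟↟↟b ↟↟↟c ↟↟a' ↟b' c' ⩑
        (rightAngle ↟b' ↟↟a' c' ⩒ rightAngle ↟↟a' c' ↟b')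

/-- `abc < π`: the supplement is positive. -/
def ltPi (a b c : Term n) : Formula n :=
  exists_ fun d => B d ↟b ↟a ⩑ posAngle d ↟b ↟c

/-- `0 < abc < π`. -/
def properAngle (a b c : Term n) : Formula n :=
  posAngle a b c ⩑ ltPi a b c

end Abbreviations

/-! ### The axioms of EG -/

section AxiomFormulas

variable {n : ℕ}

/-- Congruence: `ab = ba`. -/
def axA1 (a b : Term n) : Formula n := E a b b a

def axA2 (a b p q r s : Term n) : Formula n :=
  E a b p q ⩑ E a b r s ⟹ E p q r s

def axA3 (a b c : Term n) : Formula n := E a b c c ⟹ .eq a b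

/-- Stability of congruence. -/
def axStab (a b c d : Term n) : Formula n := ∼∼(E a b c d) ⟹ E a b c d

def axA6 (a b : Term n) : Formula n := ∼(B a b a)

def axA14 (a b c : Term n) : Formula n := B a b c ⟹ B c b a

def axA15 (a b c d : Term n) : Formula n := B a b d ⩑ B b c d ⟹ B a b c

/-- Connectivity of betweenness. -/
def axA17 (a b c d : Term n) : Formula n :=
  B a b d ⩑ B a c d ⩑ ∼(B a b c) ⩑ ∼(B a c b) ⟹ .eq b c

/-- Extension of a segment congruent to a positive one. -/
def axExtension (a b a' b' c d : Term n) : Formula n :=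
  distinct a' b' ⩑ E a b a' b' ⟹ exists_ fun e => T ↟a ↟b e ⩑ E ↟b e ↟c ↟d

def axStrictExtension (a b a' b' c d c' d' : Term n) : Formula n :=
  distinct a' b' ⩑ E a b a' b' ⩑ distinct c' d' ⩑ E c d c' d' ⟹
    exists_ fun e => B ↟a ↟b e ⩑ E ↟b e ↟c ↟d

def axFiveSegment (a b c d a' b' c' d' : Term n) : Formula n :=
  distinct a b ⩑ T a b c ⩑ T a' b' c' ⩑
    E a b a' b' ⩑ E b c b' c' ⩑ E a d a' d' ⩑ E b d b' d' ⟹ E c d c' d'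

def axInnerPasch (a b c p q : Term n) : Formula n :=
  B a p c ⩑ B b q c ⩑ (properAngle a c b ⩒ properAngle q p a) ⟹
    exists_ fun x => B ↟p x ↟b ⩑ B ↟a x ↟q

def axOuterPasch (a b c p q : Term n) : Formula n :=
  B a p c ⩑ B b c q ⩑ (properAngle b a q ⩒ properAngle a b q) ⟹
    exists_ fun x => B ↟b ↟p x ⩑ B ↟a x ↟q

/-- Strict line-circle continuity. The point `a` is strictly inside the circle with center `c` and
radius `pq`, as witnessed by the diameter `uv`; the line is the one through `a` and `b`. -/
def axLineCircle (a b c p q u v : Term n) : Formula n :=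
  distinct a b ⩑ B u a v ⩑ E c u p q ⩑ E c v p q ⩑ B u c v ⟹
    exists_ fun x => exists_ fun y =>
      L ↟↟a ↟↟b ↟x ⩑ L ↟↟a ↟↟b y ⩑
      E ↟↟c ↟x ↟↟p ↟↟q ⩑ E ↟↟c y ↟↟p ↟↟q ⩑ B ↟x ↟↟a y

/-- Non-strict line-circle continuity. -/
def axLineCircleNonstrict (a b c p q u v : Term n) : Formula n :=
  distinct a b ⩑ T u a v ⩑ E c u p q ⩑ E c v p q ⩑ T u c v ⟹
    exists_ fun x => exists_ fun y =>
      L ↟↟a ↟↟b ↟x ⩑ L ↟↟a ↟↟b y ⩑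
      E ↟↟c ↟x ↟↟p ↟↟q ⩑ E ↟↟c y ↟↟p ↟↟q ⩑ T ↟x ↟↟a y

/-- Circle-circle continuity: the circles with centers `c`, `c'` and radii `pq`, `p'q'`. -/
def axCircleCircle (a b c p q c' p' q' u v w : Term n) : Formula n :=
  E c a p q ⩑ T u a v ⩑ T u c' v ⩑ E c' u p' q' ⩑ E c' v p' q' ⩑
    E c b p q ⩑ B c' w b ⩑ E c' w p' q' ⟹
    exists_ fun e => E ↟c e ↟p ↟q ⩑ E ↟c' e ↟p' ↟q'

/-- Euclid's parallel postulate, for the transversal `pq` of the lines `sq` and `pr`. -/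
def axEuclid5 (a p q r s t : Term n) : Formula n :=
  properAngle s q p ⩑ E p t q t ⩑ B p t q ⩑ E s t r t ⩑ B s t r ⩑ E p r q s ⩑ B q a r ⟹
    exists_ fun e => B ↟p ↟a e ⩑ B ↟s ↟q e

end AxiomFormulas

/-- The lower dimension axiom. -/
def axLowerDim : Formula 0 :=
  let α : Term 0 := .const .alpha
  let β : Term 0 := .const .beta
  let γ : Term 0 := .const .gamma
  let c₁ : Term 0 := .const .c1
  let c₂ : Term 0 := .const .c2
  let c₃ : Term 0 := .const .c3
  let c₄ : Term 0 := .const .c4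
  E α β β γ ⩑ E α β α γ ⩑ ∼(.eq α β) ⩑
  B α c₁ β ⩑ E α c₁ c₁ β ⩑
  B α c₂ γ ⩑ E α c₂ c₂ γ ⩑
  B β c₃ γ ⩑ E β c₃ c₃ γ ⩑
  B β c₄ c₂ ⩑ B γ c₄ c₁

/-- The theory EG of Euclidean geometry without Markov's principle: the universal closures of the
axiom formulas above. -/
inductive Axiom : Formula 0 → Prop
  | A1 : Axiom (axA1 (n := 2) (.var 0) (.var 1)).closure
  | A2 : Axiom (axA2 (n := 6) (.var 0) (.var 1) (.var 2) (.var 3) (.var 4) (.var 5)).closure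
  | A3 : Axiom (axA3 (n := 3) (.var 0) (.var 1) (.var 2)).closure
  | stab : Axiom (axStab (n := 4) (.var 0) (.var 1) (.var 2) (.var 3)).closure
  | A6 : Axiom (axA6 (n := 2) (.var 0) (.var 1)).closure
  | A14 : Axiom (axA14 (n := 3) (.var 0) (.var 1) (.var 2)).closure
  | A15 : Axiom (axA15 (n := 4) (.var 0) (.var 1) (.var 2) (.var 3)).closure
  | A17 : Axiom (axA17 (n := 4) (.var 0) (.var 1) (.var 2) (.var 3)).closure
  | extension : Axiom (axExtension (n := 6) (.var 0) (.var 1) (.var 2) (.var 3) (.var 4)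
      (.var 5)).closure
  | strictExtension : Axiom (axStrictExtension (n := 8) (.var 0) (.var 1) (.var 2) (.var 3)
      (.var 4) (.var 5) (.var 6) (.var 7)).closure
  | fiveSegment : Axiom (axFiveSegment (n := 8) (.var 0) (.var 1) (.var 2) (.var 3)
      (.var 4) (.var 5) (.var 6) (.var 7)).closure
  | innerPasch : Axiom (axInnerPasch (n := 5) (.var 0) (.var 1) (.var 2) (.var 3)
      (.var 4)).closure
  | outerPasch : Axiom (axOuterPasch (n := 5) (.var 0) (.var 1) (.var 2) (.var 3)
      (.var 4)).closure
  | lowerDim : Axiom axLowerDim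
  | lineCircle : Axiom (axLineCircle (n := 7) (.var 0) (.var 1) (.var 2) (.var 3) (.var 4)
      (.var 5) (.var 6)).closure
  | lineCircleNonstrict : Axiom (axLineCircleNonstrict (n := 7) (.var 0) (.var 1) (.var 2)
      (.var 3) (.var 4) (.var 5) (.var 6)).closure
  | circleCircle : Axiom (axCircleCircle (n := 11) (.var 0) (.var 1) (.var 2) (.var 3) (.var 4)
      (.var 5) (.var 6) (.var 7) (.var 8) (.var 9) (.var 10)).closure
  | euclid5 : Axiom (axEuclid5 (n := 6) (.var 0) (.var 1) (.var 2) (.var 3) (.var 4)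
      (.var 5)).closure

/-- `φ` is a theorem of EG: it has an intuitionistic derivation from the axioms of EG. -/
def IsTheorem (φ : Formula 0) : Prop :=
  Derives {ψ | Axiom ψ} [] φ

end EG

/-!
Derivability is first reduced to truth in models. A set of assumptions from which a formula is not
derivable is extended, one new variable at a time, to a set that is closed under derivations,
contains a disjunct of each of its disjunctions and has a witness for each of its existential
formulas (`SaturatedModel`). So a formula that holds in all such models is derivable
(`derives_of_saturatedModel`), and the geometry can be done with the conjunctions, disjunctions and
existential quantifiers of the metalanguage. Implication and negation can only be used, not proved,
in a single model; this matters only for collinearity, which is a doubly negated disjunction, and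
there completeness is applied a second time (`Collinear.len_eq`).

The geometry has to be done without deciding whether points are distinct, and `a # b` is stronger
than `¬ a = b`. Distinctness is a property of the length
of a segment (`Distinct.of_len`), because a segment congruent to one with distinct endpoints can be
prolonged; and Pasch's axiom yields new strict betweenness relations, but only at proper angles.

* If all three sides of a right triangle have distinct endpoints, then its right angle is proper,
  and so is each of its acute angles, with the sides prolonged (`RightAngle.properAngle_acute`).
* If only the legs `ab` and `cb` of a right angle are known to have distinct endpoints, then
  line-circle continuity gives a point `k` on the prolongation of `cb` whose distance from `a` is
  twice the length of `ab`. The triangle `abk` is a right triangle of the first kind, so Pasch's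
  axiom applies to the angle `akc`, where `b` is between `k` and `c`, and gives `a # c`
  (`EqualsSupplement.distinct`).
* Hence every segment with distinct endpoints has a point strictly inside
  (`exists_bet_between`), and with such a point of the side `bc`, Pasch's axiom gives `a # c` for
  every proper angle `abc` (`ProperAngle.distinct`).
-/

namespace EG

/-! ### Substitution -/

section Substitution

variable {n m k : ℕ}

@[simp] theorem Term.subst_var (t : Term n) : t.subst Term.var = t := by
  cases t <;> rfl

@[simp] theorem Term.subst_subst (σ : Fin n → Term m) (τ : Fin m → Term k) (t : Term n) :
    (t.subst σ).subst τ = t.subst fun i => (σ i).subst τ := by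
  cases t <;> rfl

theorem Term.shift_subst_up (σ : Fin n → Term m) (t : Term n) :
    t.shift.subst (up σ) = (t.subst σ).shift := by
  cases t <;> rfl

theorem up_var : up (Term.var : Fin n → Term n) = Term.var := by
  funext i
  refine Fin.cases rfl (fun i => rfl) i

theorem up_comp (σ : Fin n → Term m) (τ : Fin m → Term k) :
    (fun i => (up σ i).subst (up τ)) = up fun i => (σ i).subst τ := by
  funext i
  refine Fin.cases rfl (fun i => ?_) i
  exact Term.shift_subst_up τ (σ i)

@[simp] theorem Formula.subst_var (φ : Formula n) : φ.subst Term.var = φ := by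
  induction φ <;> simp_all [Formula.subst, up_var]

@[simp] theorem Formula.subst_subst (φ : Formula n) {m k : ℕ} (σ : Fin n → Term m)
    (τ : Fin m → Term k) : (φ.subst σ).subst τ = φ.subst fun i => (σ i).subst τ := by
  induction φ generalizing m k <;> simp_all [Formula.subst, up_comp]

theorem Formula.shift_subst_up (σ : Fin n → Term m) (φ : Formula n) :
    φ.shift.subst (up σ) = (φ.subst σ).shift := by
  simp only [Formula.shift, Formula.subst_subst]
  rfl

theorem Formula.inst_subst (σ : Fin n → Term m) (φ : Formula (n + 1)) (t : Term n) :
    (φ.inst t).subst σ = (φ.subst (up σ)).inst (t.subst σ) := by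
  simp only [Formula.inst, Formula.subst_subst]
  congr 1
  funext i
  refine Fin.cases rfl (fun i => ?_) i
  change σ i = (σ i).shift.subst _
  rw [Term.shift, Term.subst_subst]
  exact (σ i).subst_var.symm

theorem Formula.shift_inst (φ : Formula n) (t : Term n) : φ.shift.inst t = φ := by
  simp only [Formula.inst, Formula.shift, Formula.subst_subst]
  exact φ.subst_var

theorem Formula.ofSentence_subst (σ : Fin n → Term m) (φ : Formula 0) :
    (φ.ofSentence : Formula n).subst σ = φ.ofSentence := by
  simp only [Formula.ofSentence, Formula.subst_subst]
  congr 1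
  funext i
  exact i.elim0

end Substitution

/-! ### Structural rules -/

section Structural

variable {Th : Set (Formula 0)} {n m : ℕ}

theorem Derives.weaken {Γ Δ : List (Formula n)} {φ : Formula n} (h : Derives Th Γ φ)
    (hΓ : Γ ⊆ Δ) : Derives Th Δ φ := by
  induction h with
  | ax h => exact .ax h
  | hyp h => exact .hyp (hΓ h)
  | falsumE _ ih => exact .falsumE (ih hΓ)
  | andI _ _ ih₁ ih₂ => exact .andI (ih₁ hΓ) (ih₂ hΓ)
  | andE₁ _ ih => exact .andE₁ (ih hΓ)
  | andE₂ _ ih => exact .andE₂ (ih hΓ)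
  | orI₁ _ ih => exact .orI₁ (ih hΓ)
  | orI₂ _ ih => exact .orI₂ (ih hΓ)
  | orE _ _ _ ih ih₁ ih₂ =>
    exact .orE (ih hΓ) (ih₁ (List.cons_subset_cons _ hΓ)) (ih₂ (List.cons_subset_cons _ hΓ))
  | impI _ ih => exact .impI (ih (List.cons_subset_cons _ hΓ))
  | impE _ _ ih₁ ih₂ => exact .impE (ih₁ hΓ) (ih₂ hΓ)
  | allI _ ih => exact .allI (ih (List.map_subset _ hΓ))
  | allE t _ ih => exact .allE t (ih hΓ)
  | exI t _ ih => exact .exI t (ih hΓ)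
  | exE _ _ ih₁ ih₂ =>
    exact .exE (ih₁ hΓ) (ih₂ (List.cons_subset_cons _ (List.map_subset _ hΓ)))
  | eqI t => exact .eqI t
  | eqE _ _ ih₁ ih₂ => exact .eqE (ih₁ hΓ) (ih₂ hΓ)

theorem map_shift_map_subst_up (σ : Fin n → Term m) (Γ : List (Formula n)) :
    (Γ.map Formula.shift).map (Formula.subst (up σ)) =
      (Γ.map (Formula.subst σ)).map Formula.shift := by
  simp [List.map_map, Function.comp_def, Formula.shift_subst_up]

theorem Derives.subst {Γ : List (Formula n)} {φ : Formula n} (h : Derives Th Γ φ) {m : ℕ}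
    (σ : Fin n → Term m) : Derives Th (Γ.map (Formula.subst σ)) (φ.subst σ) := by
  induction h generalizing m with
  | ax h => rw [Formula.ofSentence_subst]; exact .ax h
  | hyp h => exact .hyp (List.mem_map_of_mem h)
  | falsumE _ ih => exact .falsumE (ih σ)
  | andI _ _ ih₁ ih₂ => exact .andI (ih₁ σ) (ih₂ σ)
  | andE₁ _ ih => exact .andE₁ (ih σ)
  | andE₂ _ ih => exact .andE₂ (ih σ)
  | orI₁ _ ih => exact .orI₁ (ih σ)
  | orI₂ _ ih => exact .orI₂ (ih σ)
  | orE _ _ _ ih ih₁ ih₂ => exact .orE (ih σ) (ih₁ σ) (ih₂ σ)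
  | impI _ ih => exact .impI (ih σ)
  | impE _ _ ih₁ ih₂ => exact .impE (ih₁ σ) (ih₂ σ)
  | allI _ ih =>
    refine .allI ?_
    rw [← map_shift_map_subst_up]
    exact ih (up σ)
  | allE t _ ih => rw [Formula.inst_subst]; exact .allE _ (ih σ)
  | exI t _ ih =>
    refine .exI (t.subst σ) ?_
    rw [← Formula.inst_subst]
    exact ih σ
  | exE _ _ ih₁ ih₂ =>
    refine .exE (ih₁ σ) ?_
    rw [← map_shift_map_subst_up, ← Formula.shift_subst_up]
    exact ih₂ (up σ)
  | eqI t => exact .eqI _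
  | eqE _ _ ih₁ ih₂ =>
    rw [Formula.inst_subst] at *
    refine .eqE (ih₁ σ) ?_
    rw [← Formula.inst_subst]
    exact ih₂ σ

theorem Derives.cut {Γ Δ : List (Formula n)} {φ : Formula n} (h : Derives Th Δ φ)
    (hΔ : ∀ δ ∈ Δ, Derives Th Γ δ) : Derives Th Γ φ := by
  induction Δ generalizing φ with
  | nil => exact h.weaken (List.nil_subset _)
  | cons δ Δ ih =>
    exact .impE (ih (.impI h) fun χ hχ => hΔ χ (List.mem_cons_of_mem _ hχ))
      (hΔ δ List.mem_cons_self)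

theorem Derives.of_shift {Γ : List (Formula n)} {φ : Formula n}
    (h : Derives Th (Γ.map Formula.shift) φ.shift) : Derives Th Γ φ := by
  have h' : Derives Th ((Γ.map Formula.shift).map fun ψ => ψ.inst (.const .alpha))
    (φ.shift.inst (.const .alpha)) := h.subst _
  rw [Formula.shift_inst, List.map_map] at h'
  simpa [Function.comp_def, Formula.shift_inst] using h'

theorem Formula.up_succ_inst_zero (φ : Formula (n + 1)) :
    (φ.subst (up fun i => Term.var i.succ)).inst (.var 0) = φ := by
  rw [Formula.inst, Formula.subst_subst]
  convert φ.subst_var using 2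
  funext i
  refine Fin.cases rfl (fun i => rfl) i

theorem Derives.of_closure {φ : Formula n} (h : Derives Th [] φ.closure) : Derives Th [] φ := by
  induction n with
  | zero => exact h
  | succ n ih =>
    have h₁ := Derives.allE (.var 0) ((ih h).subst fun i => Term.var i.succ)
    rwa [Formula.up_succ_inst_zero] at h₁

theorem Derives.closure {φ : Formula n} (h : Derives Th [] φ) : Derives Th [] φ.closure := by
  induction n with
  | zero => exact h
  | succ n ih => exact ih (.allI h)

end Structural

/-! ### Saturated models -/

section Countability

/-- A number coding a term. -/
def Term.code {n : ℕ} : Term n → ℕ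
  | .var i => Nat.pair 0 i
  | .const .alpha => Nat.pair 1 0
  | .const .beta => Nat.pair 1 1
  | .const .gamma => Nat.pair 1 2
  | .const .c1 => Nat.pair 1 3
  | .const .c2 => Nat.pair 1 4
  | .const .c3 => Nat.pair 1 5
  | .const .c4 => Nat.pair 1 6

theorem Term.code_injective {n : ℕ} : Function.Injective (Term.code (n := n)) := by
  intro s t h
  rcases s with i | (_ | _) <;> rcases t with j | (_ | _) <;>
    simp_all [Term.code, Nat.pair_eq_pair, Fin.val_inj]

/-- A number coding a formula. -/
def Formula.code : {n : ℕ} → Formula n → ℕ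
  | _, .falsum => Nat.pair 0 0
  | _, .eq s t => Nat.pair 1 (Nat.pair s.code t.code)
  | _, .betw a b c => Nat.pair 2 (Nat.pair a.code (Nat.pair b.code c.code))
  | _, .cong a b c d => Nat.pair 3 (Nat.pair (Nat.pair a.code b.code) (Nat.pair c.code d.code))
  | _, .and φ ψ => Nat.pair 4 (Nat.pair φ.code ψ.code)
  | _, .or φ ψ => Nat.pair 5 (Nat.pair φ.code ψ.code)
  | _, .imp φ ψ => Nat.pair 6 (Nat.pair φ.code ψ.code)
  | _, .all φ => Nat.pair 7 φ.code
  | _, .ex φ => Nat.pair 8 φ.code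

theorem Formula.code_injective {n : ℕ} : Function.Injective (Formula.code (n := n)) := by
  intro φ ψ h
  induction φ <;> cases ψ <;>
    simp_all [Formula.code, Nat.pair_eq_pair, Term.code_injective.eq_iff] <;> grind

instance {n : ℕ} : Countable (Formula n) := Formula.code_injective.countable

instance : Countable Const :=
  Function.Injective.countable (f := fun c => (Term.const c : Term 0).code) fun a b h => by
    simpa using Term.code_injective h

end Countability

/-- The points of the models: the constants, and a supply of new points `inr 0`, `inr 1`, …; the
point `inr l` is the variable bound `l`-th from the outside. -/
abbrev Point := Const ⊕ ℕ

/-- The term for a point in a context of `m` variables; a point that is not in the context is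
sent to an arbitrary constant. -/
def Point.toTerm (m : ℕ) : Point → Term m
  | .inl c => .const c
  | .inr l => if h : l < m then .var ⟨m - 1 - l, by omega⟩ else .const .alpha

/-- The point exists in contexts of `m` variables. -/
def Point.InContext (m : ℕ) : Point → Prop
  | .inl _ => True
  | .inr l => l < m

/-- The value of a term at an assignment of points to the variables. -/
def Term.eval {m : ℕ} (ρ : Fin m → Point) : Term m → Point
  | .var i => ρ i
  | .const c => .inl c

theorem Term.toTerm_eval {m : ℕ} (k : ℕ) (ρ : Fin m → Point) (t : Term m) :
    (t.eval ρ).toTerm k = t.subst fun i => (ρ i).toTerm k := by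
  cases t <;> rfl

theorem Point.toTerm_succ {m : ℕ} {x : Point} (hx : x.InContext m) :
    x.toTerm (m + 1) = (x.toTerm m).shift := by
  rcases x with c | l
  · rfl
  · have h : l < m := hx
    simp only [Point.toTerm, h, dif_pos, Nat.lt_succ_of_lt h, Term.shift, Term.subst]
    congr 1
    ext
    simp
    omega

theorem Point.toTerm_new (m : ℕ) : Point.toTerm (m + 1) (.inr m) = .var 0 := by
  simp [Point.toTerm]

/-- A saturated model of the theory `Th`: a set of formulas with parameters that contains `Th`, is
closed under derivations, and has a disjunct of each of its disjunctions and a witness for each of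
its existential formulas. -/
structure SaturatedModel (Th : Set (Formula 0)) where
  /-- The formula holds when its variables are interpreted by the given points. -/
  Holds : {m : ℕ} → Formula m → (Fin m → Point) → Prop
  closed : ∀ {m : ℕ} {Δ : List (Formula m)} {φ : Formula m} {ρ : Fin m → Point},
    Derives Th Δ φ → (∀ δ ∈ Δ, Holds δ ρ) → Holds φ ρ
  holds_subst : ∀ {m k : ℕ} (φ : Formula m) (σ : Fin m → Term k) (ρ : Fin k → Point),
    Holds (φ.subst σ) ρ ↔ Holds φ fun i => (σ i).eval ρ
  prime : ∀ {m : ℕ} {φ ψ : Formula m} {ρ : Fin m → Point},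
    Holds (φ ⩒ ψ) ρ → Holds φ ρ ∨ Holds ψ ρ
  witness : ∀ {m : ℕ} {φ : Formula (m + 1)} {ρ : Fin m → Point},
    Holds (.ex φ) ρ → ∃ x, Holds φ (Fin.cons x ρ)

section Chain

variable {Th : Set (Formula 0)} {n : ℕ}

/-- A formula with parameters. -/
abbrev Task := Σ m : ℕ, Formula m × (Fin m → Point)

/-- The formula of a task, read in a context of `k` variables. -/
def Task.formula (k : ℕ) (t : Task) : Formula k :=
  t.2.1.subst fun i => (t.2.2 i).toTerm k

/-- One step of the construction: a new variable is added, and if the formula `χ` is a derivable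
disjunction or existential formula, then a disjunct or an instance of it is assumed. -/
theorem exists_step {Γ : List (Formula n)} {G : Formula n} (h : ¬ Derives Th Γ G)
    (χ : Formula n) :
    ∃ Γ' : List (Formula (n + 1)), ¬ Derives Th Γ' G.shift ∧ (∀ γ ∈ Γ, γ.shift ∈ Γ') ∧
      (∀ φ ψ, χ = (φ ⩒ ψ) → Derives Th Γ χ → φ.shift ∈ Γ' ∨ ψ.shift ∈ Γ') ∧
      (∀ φ, χ = .ex φ → Derives Th Γ χ → φ ∈ Γ') := by
  by_cases hχ : Derives Th Γ χ
  swap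
  · exact ⟨Γ.map Formula.shift, fun h' => h h'.of_shift, fun γ => List.mem_map_of_mem,
      fun _ _ _ h' => (hχ h').elim, fun _ _ h' => (hχ h').elim⟩
  cases χ with
  | or φ ψ =>
    by_cases h₁ : Derives Th (φ :: Γ) G
    · have h₂ : ¬ Derives Th (ψ :: Γ) G := fun h₂ => h (.orE hχ h₁ h₂)
      refine ⟨(ψ :: Γ).map Formula.shift, fun h' => h₂ h'.of_shift, fun γ hγ =>
        List.mem_map_of_mem (List.mem_cons_of_mem _ hγ), ?_, by simp⟩
      rintro _ _ ⟨⟩ -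
      simp
    · refine ⟨(φ :: Γ).map Formula.shift, fun h' => h₁ h'.of_shift, fun γ hγ =>
        List.mem_map_of_mem (List.mem_cons_of_mem _ hγ), ?_, by simp⟩
      rintro _ _ ⟨⟩ -
      simp
  | ex φ =>
    refine ⟨φ :: Γ.map Formula.shift, fun h' => h (.exE hχ h'), fun γ hγ =>
      List.mem_cons_of_mem _ (List.mem_map_of_mem hγ), by simp, ?_⟩
    rintro _ ⟨⟩ -
    simp
  | _ =>
    exact ⟨Γ.map Formula.shift, fun h' => h h'.of_shift, fun γ => List.mem_map_of_mem,
      by simp, by simp⟩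

/-- `G`, read in a context with `k` more variables. -/
def Formula.shifts (G : Formula n) : (k : ℕ) → Formula (n + k)
  | 0 => G
  | k + 1 => (G.shifts k).shift

/-- The chain of sets of assumptions obtained by treating the tasks `e 0`, `e 1`, … in turn. -/
noncomputable def chain {Γ : List (Formula n)} {G : Formula n} (h : ¬ Derives Th Γ G)
    (e : ℕ → Task) : (k : ℕ) → {Δ : List (Formula (n + k)) // ¬ Derives Th Δ (G.shifts k)}
  | 0 => ⟨Γ, h⟩
  | k + 1 =>
    let s := exists_step (chain h e k).2 ((e k).formula (n + k))
    ⟨s.choose, s.choose_spec.1⟩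

variable {Γ : List (Formula n)} {G : Formula n} (h : ¬ Derives Th Γ G) (e : ℕ → Task)

theorem chain_succ (k : ℕ) :
    (∀ γ ∈ (chain h e k).1, γ.shift ∈ (chain h e (k + 1)).1) ∧
      (∀ φ ψ, (e k).formula (n + k) = (φ ⩒ ψ) →
        Derives Th (chain h e k).1 ((e k).formula (n + k)) →
        φ.shift ∈ (chain h e (k + 1)).1 ∨ ψ.shift ∈ (chain h e (k + 1)).1) ∧
      (∀ φ, (e k).formula (n + k) = .ex φ →
        Derives Th (chain h e k).1 ((e k).formula (n + k)) →
        φ ∈ (chain h e (k + 1)).1) :=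
  (exists_step (chain h e k).2 ((e k).formula (n + k))).choose_spec.2

/-- The formula of a task is derivable from the `k`-th element of the chain. -/
def DerivesAt (k : ℕ) (t : Task) : Prop :=
  Derives Th (chain h e k).1 (t.formula (n + k))

theorem Task.formula_succ {k : ℕ} {t : Task} (ht : ∀ i, (t.2.2 i).InContext k) :
    t.formula (k + 1) = (t.formula k).shift := by
  simp only [Task.formula, Formula.shift, Formula.subst_subst]
  congr 1
  funext i
  exact Point.toTerm_succ (ht i)

theorem Task.exists_inContext (t : Task) : ∃ K, ∀ k ≥ K, ∀ i, (t.2.2 i).InContext k := by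
  obtain ⟨m, φ, ρ⟩ := t
  refine ⟨Finset.univ.sup (fun i => Sum.elim (fun _ => 0) (· + 1) (ρ i)), fun k hk i => ?_⟩
  have h₁ := (Finset.le_sup (f := fun i => Sum.elim (fun _ => 0) (· + 1) (ρ i))
    (Finset.mem_univ i)).trans hk
  dsimp only at h₁ ⊢
  rcases hi : ρ i with c | l
  · trivial
  · rw [hi] at h₁
    exact h₁

theorem DerivesAt.succ {k : ℕ} {t : Task} (ht : ∀ i, (t.2.2 i).InContext (n + k))
    (hk : DerivesAt h e k t) : DerivesAt h e (k + 1) t := by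
  have h₁ := (Derives.subst hk fun i => Term.var i.succ).weaken
    (Δ := (chain h e (k + 1)).1) fun γ hγ => by
      obtain ⟨δ, hδ, rfl⟩ := List.mem_map.1 hγ
      exact (chain_succ h e k).1 δ hδ
  change Derives Th _ ((t.formula (n + k)).shift) at h₁
  rwa [← Task.formula_succ ht] at h₁

theorem Point.InContext.mono {k l : ℕ} {x : Point} (hx : x.InContext k) (hkl : k ≤ l) :
    x.InContext l := by
  rcases x with c | i
  · trivial
  · exact lt_of_lt_of_le hx hkl

theorem DerivesAt.mono {k l : ℕ} {t : Task} (ht : ∀ i, (t.2.2 i).InContext (n + k))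
    (hk : DerivesAt h e k t) (hkl : k ≤ l) : DerivesAt h e l t := by
  induction l, hkl using Nat.le_induction with
  | base => exact hk
  | succ l hl ih => exact ih.succ h e fun i => (ht i).mono (by omega)

/-- The formula of a task is derivable from all late elements of the chain. -/
def EventuallyDerives (t : Task) : Prop := ∃ K, ∀ k ≥ K, DerivesAt h e k t

theorem eventuallyDerives_of_derivesAt {k : ℕ} {t : Task}
    (ht : ∀ i, (t.2.2 i).InContext (n + k)) (hk : DerivesAt h e k t) : EventuallyDerives h e t :=
  ⟨k, fun _ hl => hk.mono h e ht hl⟩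

/-- All tasks can be enumerated with infinitely many repetitions. -/
theorem exists_enumeration : ∃ e : ℕ → Task, ∀ t K, ∃ k ≥ K, e k = t := by
  have : Nonempty Task := ⟨⟨0, .falsum, fun i => i.elim0⟩⟩
  obtain ⟨f, hf⟩ := exists_surjective_nat Task
  refine ⟨fun k => f k.unpair.1, fun t K => ?_⟩
  obtain ⟨i, rfl⟩ := hf t
  exact ⟨Nat.pair i K, Nat.right_le_pair i K, by simp⟩

variable {e}

/-- A task is treated at a stage where its formula is derivable. -/
theorem EventuallyDerives.exists_stage (he : ∀ t K, ∃ k ≥ K, e k = t) {t : Task}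
    (ht : EventuallyDerives h e t) :
    ∃ k, e k = t ∧ (∀ i, (t.2.2 i).InContext (n + k)) ∧ DerivesAt h e k t := by
  obtain ⟨K, hK⟩ := ht
  obtain ⟨K', hK'⟩ := t.exists_inContext
  obtain ⟨k, hk, hek⟩ := he t (max K K')
  exact ⟨k, hek, hK' _ (by omega), hK k (by omega)⟩

/-- The union of the chain. -/
def chainModel (he : ∀ t K, ∃ k ≥ K, e k = t) : SaturatedModel Th where
  Holds φ ρ := EventuallyDerives h e ⟨_, φ, ρ⟩
  closed := by
    intro m Δ φ ρ hφ hΔ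
    have hK : ∃ K, ∀ k ≥ K, ∀ δ ∈ Δ, DerivesAt h e k ⟨_, δ, ρ⟩ := by
      clear hφ
      induction Δ with
      | nil => exact ⟨0, by simp⟩
      | cons δ Δ ih =>
        obtain ⟨K₁, h₁⟩ := hΔ δ List.mem_cons_self
        obtain ⟨K₂, h₂⟩ := ih fun χ hχ => hΔ χ (List.mem_cons_of_mem _ hχ)
        refine ⟨max K₁ K₂, fun k hk χ hχ => ?_⟩
        rcases List.mem_cons.1 hχ with rfl | hχ
        · exact h₁ k (by omega)
        · exact h₂ k (by omega) χ hχ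
    obtain ⟨K, hK⟩ := hK
    refine ⟨K, fun k hk => (hφ.subst fun i => (ρ i).toTerm (n + k)).cut fun χ hχ => ?_⟩
    obtain ⟨δ, hδ, rfl⟩ := List.mem_map.1 hχ
    exact hK k hk δ hδ
  holds_subst := by
    intro m k φ σ ρ
    have : ∀ l, Task.formula l ⟨_, φ.subst σ, ρ⟩ =
        Task.formula l ⟨_, φ, fun i => (σ i).eval ρ⟩ := by
      intro l
      simp only [Task.formula, Formula.subst_subst, Term.toTerm_eval]
    simp only [EventuallyDerives, DerivesAt, this]
  prime := by
    intro m φ ψ ρ ht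
    obtain ⟨k, hek, hc, hk⟩ := ht.exists_stage h he
    have hk' : ∀ χ : Formula m,
        (Task.formula (n + k) ⟨m, χ, ρ⟩).shift ∈ (chain h e (k + 1)).1 →
          EventuallyDerives h e ⟨_, χ, ρ⟩ := by
      intro χ hχ
      refine eventuallyDerives_of_derivesAt h e (k := k + 1)
        (fun i => Point.InContext.mono (hc i) (by omega)) ?_
      rw [← Task.formula_succ (t := ⟨m, χ, ρ⟩) hc] at hχ
      exact .hyp hχ
    refine Or.imp (hk' φ) (hk' ψ) ((chain_succ h e k).2.1 _ _ ?_ ?_)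
    · rw [hek]; rfl
    · rw [hek]; exact hk
  witness := by
    intro m φ ρ ht
    obtain ⟨k, hek, hc, hk⟩ := ht.exists_stage h he
    have h₁ := (chain_succ h e k).2.2 (φ.subst (up fun i => (ρ i).toTerm (n + k)))
      (by rw [hek]; rfl) (by rw [hek]; exact hk)
    refine ⟨.inr (n + k), eventuallyDerives_of_derivesAt h e (k := k + 1) (fun i => ?_) ?_⟩
    · refine Fin.cases ?_ (fun i => ?_) i
      · exact Nat.lt_succ_self _
      · exact Point.InContext.mono (hc i) (by omega)
    · have h₂ : (up fun i => (ρ i).toTerm (n + k)) =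
          fun i => ((Fin.cons (.inr (n + k)) ρ : Fin (m + 1) → Point) i).toTerm (n + k + 1) := by
        funext i
        refine Fin.cases ?_ (fun i => ?_) i
        · exact (Point.toTerm_new _).symm
        · exact (Point.toTerm_succ (hc i)).symm
      rw [h₂] at h₁
      exact .hyp h₁

/-- Completeness: what holds in all saturated models in which `Γ` holds is derivable
from `Γ`. -/
theorem derives_of_saturatedModel
    (hG : ∀ (M : SaturatedModel Th) (ρ : Fin n → Point), (∀ γ ∈ Γ, M.Holds γ ρ) → M.Holds G ρ) :
    Derives Th Γ G := by
  by_contra h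
  obtain ⟨e, he⟩ := exists_enumeration
  let ρ : Fin n → Point := fun i => .inr (n - 1 - i)
  have hρ : ∀ i, (ρ i).InContext n := fun i => by
    change n - 1 - (i : ℕ) < n
    omega
  have hvar : (fun i => (ρ i).toTerm n) = Term.var := by
    funext i
    have : n - 1 - (i : ℕ) < n := by omega
    simp only [ρ, Point.toTerm, this, dif_pos]
    congr 1
    ext
    simp
    omega
  have h₀ : ∀ φ : Formula n, Task.formula n ⟨n, φ, ρ⟩ = φ := fun φ => by
    simp [Task.formula, hvar]
  have hGk : ∀ k, G.shifts k = Task.formula (n + k) ⟨n, G, ρ⟩ := by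
    intro k
    induction k with
    | zero => exact (h₀ G).symm
    | succ k ih =>
      rw [Formula.shifts, ih]
      exact (Task.formula_succ fun i => (hρ i).mono (by simp)).symm
  obtain ⟨K, hK⟩ := hG (chainModel h he) ρ fun γ hγ =>
    eventuallyDerives_of_derivesAt h e (k := 0) hρ (.hyp (by
      rw [show Task.formula (n + 0) ⟨n, γ, ρ⟩ = γ from h₀ γ]; exact hγ))
  have hKK : Derives Th (chain h e K).1 _ := hK K le_rfl
  rw [← hGk] at hKK
  exact (chain h e K).2 hKK

end Chain

/-! ### Truth in saturated models of EG -/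

theorem Term.eval_shift {m : ℕ} (ρ : Fin m → Point) (x : Point) (t : Term m) :
    t.shift.eval (Fin.cons x ρ : Fin (m + 1) → Point) = t.eval ρ := by
  cases t <;> rfl

theorem Term.eval_var_zero {m : ℕ} (ρ : Fin m → Point) (x : Point) :
    (Term.var 0).eval (Fin.cons x ρ : Fin (m + 1) → Point) = x := rfl

namespace SaturatedModel

variable {Th : Set (Formula 0)} (M : SaturatedModel Th) {m : ℕ} {ρ : Fin m → Point}

theorem holds_and {φ ψ : Formula m} : M.Holds (φ ⩑ ψ) ρ ↔ M.Holds φ ρ ∧ M.Holds ψ ρ :=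
  ⟨fun h => ⟨M.closed (.andE₁ (.hyp List.mem_cons_self)) (List.forall_mem_singleton.2 h),
    M.closed (.andE₂ (.hyp List.mem_cons_self)) (List.forall_mem_singleton.2 h)⟩,
   fun h => M.closed (Δ := [φ, ψ]) (.andI (.hyp (by simp)) (.hyp (by simp))) (by simp [h])⟩

theorem holds_or {φ ψ : Formula m} : M.Holds (φ ⩒ ψ) ρ ↔ M.Holds φ ρ ∨ M.Holds ψ ρ := by
  refine ⟨M.prime, ?_⟩
  rintro (h | h)
  · exact M.closed (.orI₁ (.hyp List.mem_cons_self)) (List.forall_mem_singleton.2 h)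
  · exact M.closed (.orI₂ (.hyp List.mem_cons_self)) (List.forall_mem_singleton.2 h)

theorem holds_ex {φ : Formula (m + 1)} :
    M.Holds (.ex φ) ρ ↔ ∃ x, M.Holds φ (Fin.cons x ρ) := by
  refine ⟨M.witness, ?_⟩
  rintro ⟨x, hx⟩
  have h : Derives Th [φ] (Formula.ex φ).shift :=
    .exI (.var 0) (.hyp (by
      rw [show Formula.inst _ _ = φ from φ.up_succ_inst_zero]
      exact List.mem_cons_self))
  exact (M.holds_subst _ _ _).1 (M.closed h (List.forall_mem_singleton.2 hx))

theorem holds_imp {φ ψ : Formula m} (h : M.Holds (φ ⟹ ψ) ρ) (hφ : M.Holds φ ρ) :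
    M.Holds ψ ρ :=
  M.closed (Δ := [φ ⟹ ψ, φ]) (.impE (φ := φ) (.hyp (by simp)) (.hyp (by simp)))
    (by simp [h, hφ])

/-- Double negation distributes over derivable consequences. -/
theorem holds_neg_neg {φ ψ : Formula m} {Δ : List (Formula m)} (h : Derives Th (φ :: Δ) ψ)
    (hφ : M.Holds (∼∼φ) ρ) (hΔ : ∀ δ ∈ Δ, M.Holds δ ρ) : M.Holds (∼∼ψ) ρ := by
  refine M.closed (Δ := (∼∼φ) :: Δ) (.impI (.impE (φ := ∼φ) (.hyp ?_)
    (.impI (.impE (φ := ψ) (.hyp ?_) (h.weaken ?_))))) ?_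
  · exact List.mem_cons_of_mem _ List.mem_cons_self
  · exact List.mem_cons_of_mem _ List.mem_cons_self
  · exact List.cons_subset_cons _ fun χ hχ => by simp [hχ]
  · simpa [hφ] using hΔ

/-- The relation of betweenness of a model. -/
def Bet (x y z : Point) : Prop := M.Holds (.betw (.var 0) (.var 1) (.var 2)) ![x, y, z]

/-- The relation of equidistance of a model. -/
def Cong (x y z w : Point) : Prop :=
  M.Holds (.cong (.var 0) (.var 1) (.var 2) (.var 3)) ![x, y, z, w]

/-- Equality in a model. Points are not identified if they are equal in the model. -/
def Eqv (x y : Point) : Prop := M.Holds (.eq (.var 0) (.var 1)) ![x, y]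

theorem holds_betw {s t u : Term m} :
    M.Holds (.betw s t u) ρ ↔ M.Bet (s.eval ρ) (t.eval ρ) (u.eval ρ) := by
  have h := M.holds_subst (.betw (.var 0) (.var 1) (.var 2)) ![s, t, u] ρ
  rw [show (fun i => (![s, t, u] i).eval ρ) = ![s.eval ρ, t.eval ρ, u.eval ρ] by
    funext i; fin_cases i <;> rfl] at h
  exact h

theorem holds_cong {s t u v : Term m} :
    M.Holds (.cong s t u v) ρ ↔ M.Cong (s.eval ρ) (t.eval ρ) (u.eval ρ) (v.eval ρ) := by
  have h := M.holds_subst (.cong (.var 0) (.var 1) (.var 2) (.var 3)) ![s, t, u, v] ρ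
  rw [show (fun i => (![s, t, u, v] i).eval ρ) = ![s.eval ρ, t.eval ρ, u.eval ρ, v.eval ρ] by
    funext i; fin_cases i <;> rfl] at h
  exact h

theorem holds_eq {s t : Term m} :
    M.Holds (.eq s t) ρ ↔ M.Eqv (s.eval ρ) (t.eval ρ) := by
  have h := M.holds_subst (.eq (.var 0) (.var 1)) ![s, t] ρ
  rw [show (fun i => (![s, t] i).eval ρ) = ![s.eval ρ, t.eval ρ] by
    funext i; fin_cases i <;> rfl] at h
  exact h

theorem holds_exists {f : Term (m + 1) → Formula (m + 1)} :
    M.Holds (exists_ f) ρ ↔ ∃ x, M.Holds (f (.var 0)) (Fin.cons x ρ) := M.holds_ex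

variable {M}

/-- Leibniz's rule, for a formula whose variable `0` stands for `x` or `y`. -/
theorem Eqv.holds {x y : Point} (h : M.Eqv x y) (φ : Formula (m + 1))
    (hx : M.Holds φ (Fin.cons x ρ)) : M.Holds φ (Fin.cons y ρ) := by
  let ψ : Formula (m + 3) :=
    φ.subst (Fin.cases (.var 0) fun i => .var i.succ.succ.succ)
  have hψ : ∀ t : Term (m + 2), ψ.inst t = φ.subst (Fin.cases t fun i => .var i.succ.succ) := by
    intro t
    simp only [ψ, Formula.inst, Formula.subst_subst]
    congr 1
    funext i
    exact Fin.cases rfl (fun i => rfl) i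
  have h₂ : Derives Th [.eq (.var 0) (.var 1), ψ.inst (.var 0)] (ψ.inst (.var 1)) :=
    .eqE (s := .var 0) (.hyp (by simp)) (.hyp (by simp))
  have h₃ := M.closed (ρ := Fin.cons x (Fin.cons y ρ)) h₂ (by
    simp only [List.mem_cons, List.not_mem_nil, or_false, forall_eq_or_imp, forall_eq]
    refine ⟨M.holds_eq.2 h, ?_⟩
    rw [hψ, M.holds_subst]
    convert hx using 1
    funext i
    exact Fin.cases rfl (fun i => rfl) i)
  rw [hψ, M.holds_subst] at h₃
  convert h₃ using 1
  funext i
  exact Fin.cases rfl (fun i => rfl) i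

theorem Eqv.refl (x : Point) : M.Eqv x x :=
  M.holds_eq.1 (M.closed (ρ := ![x]) (.eqI (Γ := []) (.var 0)) (by simp))

theorem Eqv.symm {x y : Point} (h : M.Eqv x y) : M.Eqv y x :=
  M.holds_eq.1 (h.holds (ρ := ![x]) (.eq (.var 0) (.var 1)) (M.holds_eq.2 (.refl x)))

theorem Eqv.bet_left {x y a b : Point} (h : M.Eqv x y) (hx : M.Bet x a b) : M.Bet y a b :=
  h.holds (.betw (.var 0) (.var 1) (.var 2)) hx

theorem Eqv.cong_left {x y a b c : Point} (h : M.Eqv x y) (hx : M.Cong x a b c) :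
    M.Cong y a b c :=
  h.holds (.cong (.var 0) (.var 1) (.var 2) (.var 3)) hx

variable (M)

/-- `a # b` in a model. -/
def Distinct (a b : Point) : Prop := ∃ c, M.Bet c a b ∨ M.Bet a c b ∨ M.Bet a b c

/-- The angle `abc` equals its supplement, in a model. -/
def EqualsSupplement (a b c : Point) : Prop := ∃ d, M.Bet a b d ∧ M.Cong a b b d ∧ M.Cong a c d c

/-- `R(a,b,c)` in a model. -/
def RightAngle (a b c : Point) : Prop :=
  M.EqualsSupplement a b c ∧ M.Distinct a b ∧ M.Distinct c b ∧ M.Distinct a c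

/-- `Ray(a,b,x)` in a model. -/
def Ray (a b x : Point) : Prop := ∃ d, M.Bet d a b ∧ M.Bet d a x

/-- `apex(a,b,c)` in a model. -/
def Apex (a b c : Point) : Prop :=
  ∃ u v, M.Ray b a u ∧ M.Ray b c v ∧ M.Cong b u b v ∧ M.Distinct u v

/-- Congruence of angles in a model. -/
def AngleCong (a b c a' b' c' : Point) : Prop :=
  ∃ u' v' u v, M.Ray b a u ∧ M.Ray b c v ∧ M.Ray b' a' u' ∧ M.Ray b' c' v' ∧
    M.Cong b u b' u' ∧ M.Cong b v b' v' ∧ M.Cong u v u' v'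

/-- `0 < abc` in a model. -/
def PosAngle (a b c : Point) : Prop :=
  M.Apex a b c ∨ M.RightAngle a b c ∨ ∃ a' b' c', M.AngleCong a b c a' b' c' ∧
    (M.RightAngle b' a' c' ∨ M.RightAngle a' c' b')

/-- `abc < π` in a model. -/
def LtPi (a b c : Point) : Prop := ∃ d, M.Bet d b a ∧ M.PosAngle d b c

/-- `0 < abc < π` in a model. -/
def ProperAngle (a b c : Point) : Prop := M.PosAngle a b c ∧ M.LtPi a b c

theorem holds_distinct {a b : Term m} :
    M.Holds (distinct a b) ρ ↔ M.Distinct (a.eval ρ) (b.eval ρ) := by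
  simp only [distinct, holds_exists, holds_or, holds_betw, Term.eval_shift, Term.eval_var_zero,
    Distinct]

theorem holds_equalsSupplement {a b c : Term m} : M.Holds (equalsSupplement a b c) ρ ↔
    M.EqualsSupplement (a.eval ρ) (b.eval ρ) (c.eval ρ) := by
  simp only [equalsSupplement, holds_exists, holds_and, holds_betw, holds_cong, Term.eval_shift,
    Term.eval_var_zero, EqualsSupplement]

theorem holds_rightAngle {a b c : Term m} :
    M.Holds (rightAngle a b c) ρ ↔ M.RightAngle (a.eval ρ) (b.eval ρ) (c.eval ρ) := by
  simp only [rightAngle, holds_and, holds_equalsSupplement, holds_distinct, RightAngle]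

theorem holds_ray {a b x : Term m} :
    M.Holds (ray a b x) ρ ↔ M.Ray (a.eval ρ) (b.eval ρ) (x.eval ρ) := by
  simp only [ray, holds_exists, holds_and, holds_betw, Term.eval_shift, Term.eval_var_zero, Ray]

theorem holds_apex {a b c : Term m} :
    M.Holds (apex a b c) ρ ↔ M.Apex (a.eval ρ) (b.eval ρ) (c.eval ρ) := by
  simp only [apex, holds_exists, holds_and, holds_ray, holds_cong, holds_distinct,
    Term.eval_shift, Term.eval_var_zero, Apex]

theorem holds_angleCong {a b c a' b' c' : Term m} : M.Holds (angleCong a b c a' b' c') ρ ↔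
    M.AngleCong (a.eval ρ) (b.eval ρ) (c.eval ρ) (a'.eval ρ) (b'.eval ρ) (c'.eval ρ) := by
  simp only [angleCong, holds_exists, holds_and, holds_ray, holds_cong, Term.eval_shift,
    Term.eval_var_zero, AngleCong]

theorem holds_posAngle {a b c : Term m} :
    M.Holds (posAngle a b c) ρ ↔ M.PosAngle (a.eval ρ) (b.eval ρ) (c.eval ρ) := by
  simp only [posAngle, holds_exists, holds_and, holds_or, holds_apex, holds_rightAngle,
    holds_angleCong, Term.eval_shift, Term.eval_var_zero, PosAngle]

theorem holds_properAngle {a b c : Term m} :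
    M.Holds (properAngle a b c) ρ ↔ M.ProperAngle (a.eval ρ) (b.eval ρ) (c.eval ρ) := by
  simp only [properAngle, ltPi, holds_exists, holds_and, holds_posAngle, holds_betw,
    Term.eval_shift, Term.eval_var_zero, ProperAngle, LtPi]

end SaturatedModel

/-- The saturated models of EG. -/
abbrev Model := SaturatedModel {ψ | Axiom ψ}

namespace SaturatedModel

variable {M : Model}

/-- The matrix of an axiom holds at all points. -/
theorem holds_of_axiom {n : ℕ} {φ : Formula n} (h : Axiom φ.closure) (ρ : Fin n → Point) :
    M.Holds φ ρ := by
  have h₁ : Derives {ψ | Axiom ψ} [] (φ.closure.ofSentence : Formula 0) := .ax h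
  rw [Formula.ofSentence, show (fun i : Fin 0 => i.elim0) = (Term.var : Fin 0 → Term 0) from
    funext fun i => i.elim0, Formula.subst_var] at h₁
  exact M.closed h₁.of_closure (by simp)

theorem holds_of_imp_axiom {n : ℕ} {φ ψ : Formula n} (h : Axiom (φ ⟹ ψ).closure)
    (ρ : Fin n → Point) (hφ : M.Holds φ ρ) : M.Holds ψ ρ :=
  M.holds_imp (holds_of_axiom h ρ) hφ

theorem cong_swap (a b : Point) : M.Cong a b b a :=
  M.holds_cong.1 (holds_of_axiom .A1 ![a, b])

theorem cong_euclidean {a b p q r s : Point} (h₁ : M.Cong a b p q) (h₂ : M.Cong a b r s) :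
    M.Cong p q r s :=
  M.holds_cong.1 (holds_of_imp_axiom .A2 ![a, b, p, q, r, s]
    (M.holds_and.2 ⟨M.holds_cong.2 h₁, M.holds_cong.2 h₂⟩))

theorem eqv_of_cong {a b c : Point} (h : M.Cong a b c c) : M.Eqv a b :=
  M.holds_eq.1 (holds_of_imp_axiom .A3 ![a, b, c] (M.holds_cong.2 h))

theorem Bet.symm {a b c : Point} (h : M.Bet a b c) : M.Bet c b a :=
  M.holds_betw.1 (holds_of_imp_axiom .A14 ![a, b, c] (M.holds_betw.2 h))

theorem Bet.inner_trans {a b c d : Point} (h₁ : M.Bet a b d) (h₂ : M.Bet b c d) : M.Bet a b c :=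
  M.holds_betw.1 (holds_of_imp_axiom .A15 ![a, b, c, d]
    (M.holds_and.2 ⟨M.holds_betw.2 h₁, M.holds_betw.2 h₂⟩))

/-! ### Lengths -/

section Length

variable {M : Model}

theorem cong_refl (a b : Point) : M.Cong a b a b :=
  cong_euclidean (cong_swap b a) (cong_swap b a)

theorem Cong.symm {a b c d : Point} (h : M.Cong a b c d) : M.Cong c d a b :=
  cong_euclidean h (cong_refl a b)

variable (M)

/-- Equidistance, as an equivalence relation on segments. -/
def segmentSetoid : Setoid (Point × Point) where
  r s t := M.Cong s.1 s.2 t.1 t.2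
  iseqv := ⟨fun s => cong_refl s.1 s.2, Cong.symm, fun h₁ h₂ => cong_euclidean h₁.symm h₂⟩

/-- The length of a segment: its congruence class. Equidistance of two segments thus becomes an
equation. -/
def len (a b : Point) : Quotient (segmentSetoid M) := Quotient.mk _ (a, b)

variable {M}

theorem len_eq_iff {a b c d : Point} : len M a b = len M c d ↔ M.Cong a b c d := Quotient.eq

theorem len_comm (a b : Point) : len M a b = len M b a := len_eq_iff.2 (cong_swap a b)

theorem Eqv.len_left {x y : Point} (h : M.Eqv x y) (a : Point) :
    len M x a = len M y a :=
  len_eq_iff.2 (h.cong_left (cong_refl x a)).symm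

theorem eqv_of_len {a b c : Point} (h : len M a b = len M c c) : M.Eqv a b :=
  eqv_of_cong (len_eq_iff.1 h)

theorem Eqv.bet_right {x y a b : Point} (h : M.Eqv x y)
    (hx : M.Bet a b x) : M.Bet a b y :=
  (h.bet_left hx.symm).symm

end Length

/-! ### Betweenness and segments -/

section Segment

variable {M : Model} {a b c d a' b' c' d' : Point}

theorem Bet.distinct_left (h : M.Bet a b c) : M.Distinct a b := ⟨c, .inr (.inr h)⟩

theorem Bet.distinct_right (h : M.Bet a b c) : M.Distinct b c := ⟨a, .inl h⟩

theorem Bet.distinct (h : M.Bet a b c) : M.Distinct a c := ⟨b, .inr (.inl h)⟩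

/-- Strict extension of the segment `ab`, of which only the length is known to be positive. -/
theorem exists_bet_of_len (hab : M.Distinct a' b') (h : len M a b = len M a' b')
    (hcd : M.Distinct c d) : ∃ e, M.Bet a b e ∧ len M b e = len M c d := by
  have h₁ := holds_of_imp_axiom (M := M) .strictExtension ![a, b, a', b', c, d, c, d] (by
    simp only [holds_and, holds_distinct, holds_cong]
    exact ⟨hab, len_eq_iff.1 h, hcd, cong_refl c d⟩)
  obtain ⟨e, he⟩ := M.holds_exists.1 h₁
  rw [holds_and, holds_betw, holds_cong] at he
  exact ⟨e, he.1, len_eq_iff.2 he.2⟩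

theorem exists_bet (hab : M.Distinct a b) (hcd : M.Distinct c d) :
    ∃ e, M.Bet a b e ∧ len M b e = len M c d := exists_bet_of_len hab rfl hcd

/-- Distinctness is a property of the length of a segment. -/
theorem Distinct.of_len (hab : M.Distinct a' b') (h : len M a b = len M a' b') :
    M.Distinct a b :=
  let ⟨_, he, _⟩ := exists_bet_of_len hab h hab
  he.distinct_left

theorem Distinct.symm (h : M.Distinct a b) : M.Distinct b a := h.of_len (len_comm b a)

theorem holds_nonstrict {m : ℕ} {ρ : Fin m → Point} {s t u : Term m}
    (h : M.Bet (s.eval ρ) (t.eval ρ) (u.eval ρ)) : M.Holds (T s t u) ρ := by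
  refine M.closed (Δ := [B s t u]) (.impI (.impE (φ := B s t u)
    (.andE₁ (.andE₂ (.hyp List.mem_cons_self))) (.hyp (by simp)))) ?_
  exact List.forall_mem_singleton.2 (M.holds_betw.2 h)

/-- A form of the side-angle-side principle for the triangles `bcd` and `b'c'd'`; that their
angles at `b` and `b'` are equal is expressed by the triangles `abd` and `a'b'd'`. -/
theorem five_segment (h : M.Bet a b c) (h' : M.Bet a' b' c') (hab : len M a b = len M a' b')
    (hbc : len M b c = len M b' c') (had : len M a d = len M a' d')
    (hbd : len M b d = len M b' d') : len M c d = len M c' d' := by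
  have h₁ := holds_of_imp_axiom (M := M) .fiveSegment ![a, b, c, d, a', b', c', d'] (by
    simp only [holds_and, holds_distinct, holds_cong]
    exact ⟨h.distinct_left, holds_nonstrict h, holds_nonstrict h', len_eq_iff.1 hab,
      len_eq_iff.1 hbc, len_eq_iff.1 had, len_eq_iff.1 hbd⟩)
  exact len_eq_iff.2 (M.holds_cong.1 h₁)

/-- All degenerate segments have the same length: the segment `ba` can be prolonged by a segment
`cc`, and the end of the prolongation is `a`. -/
theorem Distinct.len_self (hab : M.Distinct a b) (c : Point) : len M a a = len M c c := by
  have h₁ := holds_of_imp_axiom (M := M) .extension ![b, a, b, a, c, c] (by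
    simp only [holds_and, holds_distinct, holds_cong]
    exact ⟨hab.symm, cong_refl b a⟩)
  obtain ⟨e, he⟩ := M.holds_exists.1 h₁
  have he' : len M a e = len M c c := len_eq_iff.2 (M.holds_cong.1 (M.holds_and.1 he).2)
  exact ((eqv_of_len he').len_left a).trans ((len_comm e a).trans he')

/-- The end of a prolongation is determined by its length. -/
theorem Bet.eqv (h : M.Bet a b c) (h' : M.Bet a b d) (hbc : len M b c = len M b d) :
    M.Eqv c d :=
  (eqv_of_len (five_segment (d := c) h h' rfl hbc rfl rfl).symm).symm

theorem Bet.outer_trans_right (h₁ : M.Bet a b c) (h₂ : M.Bet b c d) : M.Bet a c d := by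
  obtain ⟨e, he, hce⟩ := exists_bet h₁.distinct h₂.distinct_right
  have hbe : M.Bet b c e := (he.symm.inner_trans h₁.symm).symm
  exact (hbe.eqv h₂ hce).bet_right he

theorem Bet.outer_trans (h₁ : M.Bet a b c) (h₂ : M.Bet b c d) : M.Bet a b d :=
  (h₂.symm.outer_trans_right h₁.symm).symm

theorem Bet.exchange (h₁ : M.Bet a b c) (h₂ : M.Bet a c d) : M.Bet b c d :=
  (h₂.symm.inner_trans h₁.symm).symm

theorem len_add (h : M.Bet a b c) (h' : M.Bet a' b' c') (hab : len M a b = len M a' b')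
    (hbc : len M b c = len M b' c') : len M a c = len M a' c' := by
  rw [len_comm a, len_comm a']
  exact five_segment h h' hab hbc (h.distinct_left.len_self _)
    (by rw [len_comm b, hab, len_comm a'])

theorem inner_five_segment (h : M.Bet a b c) (h' : M.Bet a' b' c')
    (hac : len M a c = len M a' c') (hbc : len M b c = len M b' c')
    (had : len M a d = len M a' d') (hcd : len M c d = len M c' d') :
    len M b d = len M b' d' := by
  obtain ⟨e, he, hce⟩ := exists_bet h.distinct h.distinct
  obtain ⟨e', he', hce'⟩ := exists_bet h'.distinct h.distinct
  have hec : len M c e = len M c' e' := hce.trans hce'.symm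
  have hed := five_segment he he' hac hec had hcd
  rw [len_comm b, len_comm b'] at hbc
  rw [len_comm c, len_comm c'] at hec
  exact five_segment (h.exchange he).symm (h'.exchange he').symm hec hbc hed hcd

end Segment

/-! ### Right angles -/

section Right

variable {M : Model} {a b c p q p' q' : Point}

/-- The reflection in a point `a` is an isometry. The proof is Gupta's: the segments `pp'` and
`qq'` are prolonged to segments `xx'` and `yy'` of the same length. -/
theorem len_reflection (hp : M.Bet p a p') (hpp : len M p a = len M a p') (hq : M.Bet q a q')
    (hqq : len M q a = len M a q') : len M p q = len M p' q' := by
  obtain ⟨x, hx, hpx⟩ := exists_bet hp.distinct.symm hq.distinct_left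
  obtain ⟨x', hx', hpx'⟩ := exists_bet hp.distinct hq.distinct_left
  obtain ⟨y, hy, hqy⟩ := exists_bet hq.distinct.symm hp.distinct_left
  obtain ⟨y', hy', hqy'⟩ := exists_bet hq.distinct hp.distinct_left
  have hax : M.Bet a p x := hp.symm.exchange hx
  have hax' : M.Bet a p' x' := hp.exchange hx'
  have hay : M.Bet a q y := hq.symm.exchange hy
  have hay' : M.Bet a q' y' := hq.exchange hy'
  have hxx : M.Bet x a x' := (hax.symm.outer_trans_right hp).outer_trans hax'
  have hyy : M.Bet y a y' := (hay.symm.outer_trans_right hq).outer_trans hay'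
  have lax' : len M a x = len M a x' := len_add hax hax' (by grind [len_comm]) (by grind)
  have lay' : len M a y = len M a y' := len_add hay hay' (by grind [len_comm]) (by grind)
  have lxy : len M a x = len M a y := (len_add hax hay.symm (by grind [len_comm])
    (by grind [len_comm])).trans (len_comm y a)
  have l₁ : len M x' y' = len M y x := five_segment hxx hyy.symm (by grind [len_comm])
    (by grind) (len_comm _ _) (by grind)
  have l₂ : len M q x = len M q' x' := inner_five_segment hay.symm hay'.symm
    (by grind [len_comm]) (by grind [len_comm]) (by grind [len_comm]) lax'
  exact inner_five_segment hax.symm hax'.symm (by grind [len_comm]) (by grind [len_comm])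
    (by grind [len_comm]) (by grind [len_comm])

/-- Equality with the supplement is symmetric in the legs: the reflection in `b` is an isometry,
so it moves the equal distances of `c` from `a` and `d` to the reflection of `c`. -/
theorem EqualsSupplement.symm (h : M.EqualsSupplement a b c) (hcb : M.Distinct c b) :
    M.EqualsSupplement c b a := by
  obtain ⟨d, had, h₁, h₂⟩ := h
  obtain ⟨e, hce, h₃⟩ := exists_bet hcb hcb.symm
  have h₄ := len_reflection hce (by grind [len_comm]) had.symm
    (by grind [len_comm, len_eq_iff])
  exact ⟨e, hce, len_eq_iff.1 (by grind [len_comm]), len_eq_iff.1 (by grind [len_comm, len_eq_iff])⟩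

theorem EqualsSupplement.opposite (h : M.EqualsSupplement a b c) {k : Point}
    (hk : M.Bet c b k) : M.EqualsSupplement a b k := by
  obtain ⟨d, had, h₁, h₂⟩ := h
  have h₃ : len M k a = len M k d := five_segment hk hk rfl rfl
    (by grind [len_comm, len_eq_iff]) (by grind [len_comm, len_eq_iff])
  exact ⟨d, had, h₁, len_eq_iff.1 (by grind [len_comm])⟩

theorem RightAngle.symm (h : M.RightAngle a b c) : M.RightAngle c b a :=
  ⟨h.1.symm h.2.2.1, h.2.2.1, h.2.1, h.2.2.2.symm⟩

theorem RightAngle.exists_supplement (h : M.RightAngle a b c) :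
    ∃ d, M.Bet d b a ∧ M.RightAngle d b c := by
  obtain ⟨⟨d, hd, h₁, h₂⟩, -, hcb, hac⟩ := h
  exact ⟨d, hd.symm, ⟨a, hd.symm, len_eq_iff.1 (by grind [len_comm, len_eq_iff]), h₂.symm⟩,
    hd.distinct_right.symm, hcb, hac.of_len (len_eq_iff.2 h₂.symm)⟩

theorem RightAngle.properAngle (h : M.RightAngle a b c) : M.ProperAngle a b c :=
  let ⟨d, hd, h'⟩ := h.exists_supplement
  ⟨.inr (.inl h), d, hd, .inr (.inl h')⟩

theorem inner_pasch {a b c p q : Point} (hp : M.Bet a p c) (hq : M.Bet b q c)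
    (h : M.ProperAngle a c b ∨ M.ProperAngle q p a) : ∃ x, M.Bet p x b ∧ M.Bet a x q := by
  have h₁ := holds_of_imp_axiom (M := M) .innerPasch ![a, b, c, p, q] (by
    simp only [holds_and, holds_or, holds_betw, holds_properAngle]
    exact ⟨hp, hq, h⟩)
  obtain ⟨x, hx⟩ := M.holds_exists.1 h₁
  rw [holds_and, holds_betw, holds_betw] at hx
  exact ⟨x, hx⟩

/-- The acute angle of a right triangle is a proper angle: if the leg `kb` is laid off from `k` on
the prolongation of the hypotenuse `ak`, then an application of Pasch's axiom at the right angle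
shows that the end of it is distinct from `b`, so that the supplement is an apex angle. -/
theorem RightAngle.properAngle_acute {k a₂ : Point} (h : M.RightAngle a b k)
    (ha : M.Bet k a a₂) (hc : M.Ray k c b) : M.ProperAngle a₂ k c := by
  have hkb := h.2.2.1
  obtain ⟨u, hu, hku⟩ := exists_bet h.2.2.2 hkb
  have hua₂ : M.Bet u k a₂ := hu.symm.outer_trans ha
  refine ⟨.inr (.inr ⟨a, k, b, ?_, .inr h⟩), u, hua₂, .inl ?_⟩
  · obtain ⟨d, hd⟩ := exists_bet hkb.symm hkb
    exact ⟨a, b, a, b, ⟨u, hua₂, hu.symm⟩, hc, ⟨u, hu.symm, hu.symm⟩,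
      ⟨d, hd.1.symm, hd.1.symm⟩, cong_refl _ _, cong_refl _ _, cong_refl _ _⟩
  · obtain ⟨a', ha', h'⟩ := h.exists_supplement
    obtain ⟨x, hx, -⟩ := inner_pasch ha' hu.symm (.inr h'.symm.properAngle)
    exact ⟨u, b, ⟨a, hu, hu⟩, hc, len_eq_iff.1 hku, hx.distinct.symm⟩

end Right

/-! ### Distinct points on the sides of an angle -/

section Angle

variable {M : Model} {a b c c' k x : Point}

/-- The disjunction is the one inside the double negation that defines collinearity. If `x` is on
the ray from `b` through `c`, then the figure `c'`, `b`, `x` is the mirror image of `c`, `b`,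
`k`. -/
theorem len_eq_of_collinear (hk : M.Bet c b k) (hbx : len M b x = len M b k)
    (hc' : M.Bet c b c') (hbc : len M c b = len M b c') (hac : len M a c = len M a c')
    (hx : M.Bet x b c ∨ M.Eqv x b ∨ M.Bet b x c ∨ M.Eqv x c ∨ M.Bet b c x) :
    len M a x = len M a k := by
  have key : M.Bet c' b x → len M a x = len M a k := fun h => by
    rw [len_comm a, len_comm a]
    exact five_segment h hk (by grind [len_comm]) hbx (by grind [len_comm]) rfl
  rcases hx with hx | hx | hx | hx | hx
  · rw [len_comm a, len_comm a]
    exact five_segment hx.symm hk rfl hbx rfl rfl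
  -- In the degenerate case `x` and `k` are both equal to `b`.
  · have hb : len M b x = len M b b := (len_comm b x).trans (hx.len_left b)
    have hkb : M.Eqv k b := eqv_of_len (c := b) ((len_comm k b).trans (hbx.symm.trans hb))
    rw [len_comm a, len_comm a, hx.len_left, hkb.len_left]
  · exact key (hc'.symm.inner_trans hx)
  · exact key (hx.symm.bet_right hc'.symm)
  · exact key (hc'.symm.outer_trans hx)

variable (M) in
/-- Collinearity in a model. -/
def Collinear (a b c : Point) : Prop := M.Holds (L (.var 0) (.var 1) (.var 2)) ![a, b, c]

theorem holds_collinear {m : ℕ} {ρ : Fin m → Point} {s t u : Term m} :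
    M.Holds (L s t u) ρ ↔ M.Collinear (s.eval ρ) (t.eval ρ) (u.eval ρ) := by
  have h := M.holds_subst (L (.var 0) (.var 1) (.var 2)) ![s, t, u] ρ
  rw [show (fun i => (![s, t, u] i).eval ρ) = ![s.eval ρ, t.eval ρ, u.eval ρ] by
    funext i; fin_cases i <;> rfl] at h
  exact h

/-- Equidistance is stable. -/
theorem cong_of_not_not {m : ℕ} {ρ : Fin m → Point} {s t u v : Term m}
    (h : M.Holds (∼∼(E s t u v)) ρ) : M.Cong (s.eval ρ) (t.eval ρ) (u.eval ρ) (v.eval ρ) :=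
  holds_of_imp_axiom .stab ![s.eval ρ, t.eval ρ, u.eval ρ, v.eval ρ] <| by
    have h₁ : ∼∼(E s t u v) =
        Formula.subst ![s, t, u, v] ∼∼(E (.var 0) (.var 1) (.var 2) (.var 3)) := by
      simp [Formula.neg, Formula.subst, Term.subst]
    rw [h₁, M.holds_subst] at h
    convert h using 1
    funext i
    fin_cases i <;> rfl

/-- If `a` is equidistant from `c` and its reflection `c'` in `b`, then it is equidistant from
each point `x` of the line `bc` and its reflection. Collinearity is a doubly negated disjunction:
the cases of the disjunction are treated in all models, so that the equation is derivable from each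
of them; and equidistance is stable. -/
theorem Collinear.len_eq (hx : M.Collinear b c x) (hk : M.Bet c b k)
    (hbx : len M b x = len M b k) (hc' : M.Bet c b c') (hbc : len M c b = len M b c')
    (hac : len M a c = len M a c') : len M a x = len M a k := by
  let a' : Term 6 := .var 0
  let b' : Term 6 := .var 1
  let c₁ : Term 6 := .var 2
  let c₂ : Term 6 := .var 3
  let k' : Term 6 := .var 4
  let x' : Term 6 := .var 5
  let Δ : List (Formula 6) :=
    [B c₁ b' k', E b' x' b' k', B c₁ b' c₂, E c₁ b' b' c₂, E a' c₁ a' c₂]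
  have h₁ : Derives {ψ | Axiom ψ}
      ((B x' b' c₁ ⩒ .eq x' b' ⩒ B b' x' c₁ ⩒ .eq x' c₁ ⩒ B b' c₁ x') :: Δ)
      (E a' x' a' k') := by
    refine derives_of_saturatedModel fun N ρ hN => ?_
    simp only [Δ, List.forall_mem_cons, holds_or, holds_betw, holds_eq, holds_cong] at hN ⊢
    simp only [← len_eq_iff] at hN ⊢
    obtain ⟨h, hk, hbx, hc', hbc, hac, -⟩ := hN
    exact len_eq_of_collinear hk hbx hc' hbc hac h
  have h₂ := M.holds_neg_neg (ρ := ![a, b, c, c', k, x]) h₁ (M.holds_collinear.2 hx) (by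
    simp only [Δ, List.forall_mem_cons, holds_betw, holds_cong]
    exact ⟨hk, len_eq_iff.1 hbx, hc', len_eq_iff.1 hbc, len_eq_iff.1 hac, by simp⟩)
  exact len_eq_iff.2 (cong_of_not_not h₂)

theorem line_circle {a b c p q u v : Point} (hab : M.Distinct a b) (hu : M.Bet u a v)
    (hcu : len M c u = len M p q) (hcv : len M c v = len M p q) (hc : M.Bet u c v) :
    ∃ x y, M.Collinear a b x ∧ M.Bet x a y ∧ len M c x = len M p q := by
  have h₁ := holds_of_imp_axiom (M := M) .lineCircle ![a, b, c, p, q, u, v] (by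
    simp only [holds_and, holds_distinct, holds_betw, holds_cong]
    exact ⟨hab, hu, len_eq_iff.1 hcu, len_eq_iff.1 hcv, hc⟩)
  obtain ⟨x, hx⟩ := M.holds_exists.1 h₁
  obtain ⟨y, hy⟩ := M.holds_exists.1 hx
  simp only [holds_and, holds_collinear, holds_cong, holds_betw] at hy
  exact ⟨x, y, hy.1, hy.2.2.2.2, len_eq_iff.2 hy.2.2.1⟩

/-- In a right triangle with given legs, the endpoints of the hypotenuse are distinct. On the
prolongation of the leg `cb` there is a point `k` such that the distance of `a` and `k` is twice
that of `a` and `b`. So `akb` is an acute angle of a right triangle of which all sides are known to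
have distinct endpoints, and Pasch's axiom applies to the angle `akc`. -/
theorem EqualsSupplement.distinct (h : M.EqualsSupplement a b c) (hab : M.Distinct a b)
    (hcb : M.Distinct c b) : M.Distinct a c := by
  obtain ⟨c', hc', hbc, hac⟩ := h.symm hcb
  obtain ⟨d, hd, -⟩ := id h
  -- The circle with center `a` through the reflection `d` of `a` in `b` contains `b` inside the
  -- diameter `dv`, so it meets the line `bc`.
  obtain ⟨v, hv, hav⟩ := exists_bet hd.distinct.symm hd.distinct
  obtain ⟨x, y, hx, hxy, hax⟩ := line_circle (p := a) (q := d) hcb.symm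
    (hd.symm.outer_trans (hd.symm.exchange hv)) rfl hav hv
  -- Whether `x` or its mirror image is on the side of `b` opposite to `c` cannot be decided, so
  -- `k` is obtained by prolonging `cb` by the length of `bx`.
  obtain ⟨k, hk, hbk⟩ := exists_bet hcb hxy.distinct_left.symm
  have hak : len M a k = len M a d :=
    (hx.len_eq hk hbk.symm hc' (len_eq_iff.2 hbc) (by grind [len_comm, len_eq_iff])).symm.trans
      hax
  have hr : M.RightAngle a b k :=
    ⟨h.opposite hk, hab, hk.distinct_right.symm, hd.distinct.of_len hak⟩
  obtain ⟨e, he, -⟩ := exists_bet hk.distinct_right hab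
  obtain ⟨a₂, ha₂, -⟩ := exists_bet hr.2.2.2.symm hab
  obtain ⟨z, hz, -⟩ := inner_pasch ha₂.symm hk
    (.inl (hr.properAngle_acute ha₂ ⟨e, he.symm.outer_trans hk.symm, he.symm⟩))
  exact hz.distinct

/-- Every segment with distinct endpoints has a point strictly between them. It suffices to find
one in some segment `po` of the same length. This is placed along a side of the given equilateral
triangle, where `o` is the midpoint of the side; the altitude `βo` has a given interior point `q`,
and Pasch's axiom is applied at the acute angle at `β` of the right triangle `poβ`. -/
theorem exists_bet_between (hbc : M.Distinct b c) : ∃ x, M.Bet b x c := by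
  let α : Point := .inl .alpha
  let β : Point := .inl .beta
  let γ : Point := .inl .gamma
  let o : Point := .inl .c2
  let q : Point := .inl .c4
  have hdim := holds_of_axiom (M := M) (n := 0) .lowerDim fun i => i.elim0
  simp only [holds_and, holds_betw, holds_cong] at hdim
  obtain ⟨h₁, -, -, -, -, hαγ, h₃, -, -, hβ, -⟩ := hdim
  change M.Cong α β β γ at h₁
  change M.Bet α o γ at hαγ
  change M.Cong α o o γ at h₃
  change M.Bet β q o at hβ
  have hs : M.EqualsSupplement α o β :=
    ⟨γ, hαγ, h₃, len_eq_iff.1 ((len_eq_iff.2 h₁).trans (len_comm _ _))⟩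
  obtain ⟨p, hp, hop⟩ := exists_bet hαγ.distinct_left hbc
  have hs' : M.EqualsSupplement β o p := (hs.symm hβ.distinct).opposite hp
  have hr : M.RightAngle p o β := ⟨hs'.symm hp.distinct_right.symm, hp.distinct_right.symm,
    hβ.distinct, (hs'.distinct hβ.distinct hp.distinct_right.symm).symm⟩
  obtain ⟨p₂, hp₂, -⟩ := exists_bet hr.2.2.2.symm hbc
  obtain ⟨e, he, -⟩ := exists_bet hβ.distinct.symm hbc
  obtain ⟨x, hx, -⟩ := inner_pasch hp₂.symm hβ.symm
    (.inl (hr.properAngle_acute hp₂ ⟨e, he.symm, he.symm⟩))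
  -- The segment `po` is carried over to `bc`.
  obtain ⟨d, hd, -⟩ := exists_bet hbc.symm hbc
  obtain ⟨y, hy, hby⟩ := exists_bet hd.distinct_right.symm hx.symm.distinct_left
  obtain ⟨c₁, hc₁, hyc⟩ := exists_bet hy.distinct_right hx.symm.distinct_right
  have hbc₁ : len M b c₁ = len M b c := (len_add hc₁ hx.symm hby hyc).trans hop
  exact ⟨y, ((hy.outer_trans hc₁).eqv hd.symm hbc₁).bet_right hc₁⟩

theorem Ray.distinct (h : M.Ray b a x) : M.Distinct a b :=
  let ⟨_, hd, _⟩ := h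
  hd.distinct_right.symm

theorem Ray.prolong {a₂ : Point} (h : M.Ray b a x) (ha : M.Bet b a a₂) : M.Ray b a₂ x :=
  let ⟨d, hd, hx⟩ := h
  ⟨d, hd.outer_trans ha, hx⟩

/-- Pasch's axiom is applied to the angle with the side `ba` prolonged. If `0 < abc` holds because
`abc` is an apex angle or an acute angle of a right triangle, then it also holds for the prolonged
angle, as only the rays matter. For a right angle the sides matter, but there `a # c` is part of the
definition. -/
theorem ProperAngle.distinct (h : M.ProperAngle a b c) : M.Distinct a c := by
  obtain ⟨h, d, hd, h'⟩ := h
  have key : M.Distinct c b → (∀ a₂, M.Bet b a a₂ → M.PosAngle a₂ b c) → M.Distinct a c := by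
    intro hcb hpos
    obtain ⟨a₂, ha₂, -⟩ := exists_bet hd.distinct_right hcb
    obtain ⟨q, hq⟩ := exists_bet_between hcb
    obtain ⟨x, hx, -⟩ := inner_pasch ha₂.symm hq
      (.inl ⟨hpos a₂ ha₂, d, hd.outer_trans ha₂, h'⟩)
    exact hx.distinct
  rcases h with ⟨u, v, hu, hv, huv⟩ | h | ⟨a', b', c', ⟨u', v', u, v, hu, hv, h₁⟩, h₂⟩
  · exact key hv.distinct fun a₂ ha => .inl ⟨u, v, hu.prolong ha, hv, huv⟩
  · exact h.2.2.2
  · exact key hv.distinct fun a₂ ha =>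
      .inr (.inr ⟨a', b', c', ⟨u', v', u, v, hu.prolong ha, hv, h₁⟩, h₂⟩)

end Angle

end SaturatedModel

end EG

/-- In EG: if `0 < abc < π`, then `a # c`; and if `abc` is a right angle of which only the legs
`ab` and `cb` are assumed to have distinct endpoints, then `a # c`. -/
theorem mainTheorem5 :
    EG.IsTheorem
      (EG.Formula.imp
        (EG.properAngle (n := 3) (.var 0) (.var 1) (.var 2))
        (EG.distinct (.var 0) (.var 2))).closure ∧
    EG.IsTheorem
      (EG.Formula.imp
        (EG.Formula.and (EG.equalsSupplement (n := 3) (.var 0) (.var 1) (.var 2))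
          (EG.Formula.and (EG.distinct (.var 0) (.var 1)) (EG.distinct (.var 2) (.var 1))))
        (EG.distinct (.var 0) (.var 2))).closure := by
  constructor <;> refine EG.Derives.closure (.impI (EG.derives_of_saturatedModel fun M ρ h => ?_))
  · have h := List.forall_mem_singleton.1 h
    rw [EG.SaturatedModel.holds_properAngle] at h
    exact M.holds_distinct.2 h.distinct
  · have h := List.forall_mem_singleton.1 h
    simp only [EG.SaturatedModel.holds_and, EG.SaturatedModel.holds_equalsSupplement,
      EG.SaturatedModel.holds_distinct] at h
    exact M.holds_distinct.2 (h.1.distinct h.2.1 h.2.2)
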